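/- **Gray map.** For $s\ge 1$ and $u=\sum_{i=0}^{s-1}u_i2^i\in\mathbb{Z}_{2^s}$ with $u_i\in\{0,1\}$, let $$\phi_s(u)=(u_{s-1},\dots,u_{s-1})+(u_0,\dots,u_{s-2})\,Y_{s-1}\in\mathbb{Z}_2^{2^{s-1}},$$ where $Y_{s-1}$ is the $(s-1)\times 2^{s-1}$ matrix whose columns are the vectors $(j_0,\dots,j_{s-2})^T$ of binary digits of $j=\sum_i j_i2^i$, for $j=0,1,\dots,2^{s-1}-1$ in this order ($\phi_1$ is the identity). Let $\Phi:\mathbb{Z}_2^{\alpha_1}\times\mathbb{Z}_4^{\alpha_2}\times\mathbb{Z}_8^{\alpha_3}\to\mathbb{Z}_2^{\alpha_1+2\alpha_2+4\alpha_3}$ be given by $\Phi(u_1\mid u_2\mid u_3)=(u_1,\Phi_2(u_2),\Phi_3(u_3))$, where $\Phi_s$ applies $\phi_s$ to each coordinate. **Codes.** A binary code $C\subseteq\mathbb{Z}_2^n$ is linear if it is a subspace of $\mathbb{Z}_2^n$, and nonlinear otherwise. Its kernel is $K(C)=\{x\in\mathbb{Z}_2^n : x+C=C\}$. **Construction.**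 Write $\mathbf{a}$ for a constant row $(a,\dots,a)$ of the appropriate length. Define matrices $A^{t_1,t_2,t_3}=(A_1\mid A_2\mid A_3)$ for integers $t_1\ge1$, $t_2\ge0$, $t_3\ge1$, where $A_i$ has entries in $\mathbb{Z}_{2^i}$ and $\alpha_i$ columns, as follows. Start from $$A^{1,0,1}=\left(\begin{array}{cc|c|c}1&1&2&4\\0&1&1&1\end{array}\right).$$ (i) From $A^{\ell-1,0,1}=(A_1\mid A_2\mid A_3)$, $\ell\ge2$, form $$A^{\ell,0,1}=\left(\begin{array}{cc|ccccc|ccccc}A_1&A_1&M_1&A_2&A_2&A_2&A_2&M_2&A_3&A_3&\cdots&A_3\\ \mathbf 0&\mathbf 1&\mathbf 1&\mathbf 0&\mathbf 1&\mathbf 2&\mathbf 3&\mathbf 1&\mathbf 0&\mathbf 1&\cdots&\mathbf 7\end{array}\right),$$ where the columns of $M_1$ are the elements of $\{2\}\times\{0,2\}^{\ell-1}$ and those of $M_2$ are the elements of $\{4\}\times\{0,2,4,6\}^{\ell-1}$, each once, in lexicographic order; repeat until $\ell=t_1$. (ii) From $A^{t_1,\ell-1,1}=(A_1\mid A_2\mid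 A_3)$, $\ell\ge1$, form $$A^{t_1,\ell,1}=\left(\begin{array}{cc|ccccc|cccc}A_1&A_1&M_1&A_2&A_2&A_2&A_2&A_3&A_3&A_3&A_3\\ \mathbf 0&\mathbf 1&\mathbf 1&\mathbf 0&\mathbf 1&\mathbf 2&\mathbf 3&\mathbf 0&\mathbf 2&\mathbf 4&\mathbf 6\end{array}\right),$$ where the columns of $M_1$ are the elements of $\{2\}\times\{0,2\}^{t_1+\ell-1}$, each once, in lexicographic order; repeat until $\ell=t_2$. (iii) From $A^{t_1,t_2,\ell-1}=(A_1\mid A_2\mid A_3)$, $\ell\ge2$, form $$A^{t_1,t_2,\ell}=\left(\begin{array}{cc|cc|cc}A_1&A_1&A_2&A_2&A_3&A_3\\ \mathbf 0&\mathbf 1&\mathbf 0&\mathbf 2&\mathbf 0&\mathbf 4\end{array}\right);$$ repeat until $\ell=t_3$. Let $\mathcal{H}^{t_1,t_2,t_3}$, the (recursively constructed) $\mathbb{Z}_2\mathbb{Z}_4\mathbb{Z}_8$-additive Hadamard code, be the subgroup of $\mathbb{Z}_2^{\alpha_1}\times\mathbb{Z}_4^{\alpha_2}\times\mathbb{Z}_8^{\alpha_3}$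 generated by the rows of $A^{t_1,t_2,t_3}$. **Theorem.** Let $t_1\ge1$, $t_2\ge0$ and $t_3\ge1$ be integers, and let $\mathcal{H}=\mathcal{H}^{t_1,t_2,t_3}$. Suppose that the binary code $\Phi(\mathcal{H})$ is nonlinear. Let $\mathcal{H}_2$ be the set of all codewords of $\mathcal{H}$ of order at most two. Then $K(\Phi(\mathcal{H}))=\Phi(\mathcal{H}_2)$. -/

import Mathlib

/-! # Additive codes over `ℤ₂`, `ℤ₄`, `ℤ₈`, their Gray images, and the recursive construction -/

namespace Z2Z4Z8

/-! ## Binary codes -/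

/-- A binary code is linear if it is a subspace of the space of all binary vectors. -/
def IsLinearCode {ι : Type*} (C : Set (ι → ZMod 2)) : Prop :=
  ∃ W : Submodule (ZMod 2) (ι → ZMod 2), (W : Set (ι → ZMod 2)) = C

/-- The kernel `K(C) = {x : x + C = C}` of a binary code. -/
def codeKernel {ι : Type*} (C : Set (ι → ZMod 2)) : Set (ι → ZMod 2) :=
  {x | (fun c => x + c) '' C = C}

/-! ## Carlet's Gray map -/

/-- The binary digit of `n` at the place `2 ^ i`, as an element of `ℤ₂`. -/
def bit (n i : ℕ) : ZMod 2 := if n.testBit i then 1 else 0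

/-- Carlet's Gray map `φ_s : ℤ_{2^s} → ℤ₂^{2^(s-1)}` for `s ≥ 1`: for `u = ∑ u_i 2^i`,
`φ_s(u) = (u_{s-1}, …, u_{s-1}) + (u_0, …, u_{s-2}) Y`, where the column of `Y` at the
place `j ∈ {0, …, 2^(s-1) - 1}` is the binary expansion of `j`, least significant digit first. -/
def gray (s : ℕ) (u : ZMod (2 ^ s)) : Fin (2 ^ (s - 1)) → ZMod 2 :=
  fun j => bit u.val (s - 1) + ∑ i ∈ Finset.range (s - 1), bit u.val i * bit j i

/-- The ambient group `ℤ₂^{α₁} × ℤ₄^{α₂} × ℤ₈^{α₃}`. -/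
abbrev Mixed (α₁ α₂ α₃ : ℕ) : Type :=
  (Fin α₁ → ZMod 2) × (Fin α₂ → ZMod 4) × (Fin α₃ → ZMod 8)

/-- The `α₁ + 2 α₂ + 4 α₃` coordinate places of a Gray image. -/
abbrev Place (α₁ α₂ α₃ : ℕ) : Type :=
  Fin α₁ ⊕ (Fin α₂ × Fin 2) ⊕ (Fin α₃ × Fin 4)

/-- The Gray map `Φ(u₁ ∣ u₂ ∣ u₃) = (u₁, Φ₂(u₂), Φ₃(u₃))`, with `Φ_s` equal to `φ_s` on each
coordinate. -/
def Gray {α₁ α₂ α₃ : ℕ} (u : Mixed α₁ α₂ α₃) : Place α₁ α₂ α₃ → ZMod 2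
  | .inl j => u.1 j
  | .inr (.inl (j, k)) => gray 2 (u.2.1 j) k
  | .inr (.inr (j, k)) => gray 3 (u.2.2 j) k

/-! ## Generator matrices -/

/-- A matrix `(A₁ ∣ A₂ ∣ A₃)` with `r` rows, given by the lists of its columns over `ℤ₂`,
over `ℤ₄` and over `ℤ₈`. -/
structure GenMatrix (r : ℕ) where
  /-- the columns over `ℤ₂` -/
  cols₁ : List (Fin r → ZMod 2)
  /-- the columns over `ℤ₄` -/
  cols₂ : List (Fin r → ZMod 4)
  /-- the columns over `ℤ₈` -/
  cols₃ : List (Fin r → ZMod 8)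

namespace GenMatrix

variable {r : ℕ}

/-- The number `α₁` of columns over `ℤ₂`. -/
abbrev α₁ (A : GenMatrix r) : ℕ := A.cols₁.length

/-- The number `α₂` of columns over `ℤ₄`. -/
abbrev α₂ (A : GenMatrix r) : ℕ := A.cols₂.length

/-- The number `α₃` of columns over `ℤ₈`. -/
abbrev α₃ (A : GenMatrix r) : ℕ := A.cols₃.length

/-- The `i`-th row. -/
def row (A : GenMatrix r) (i : Fin r) : Mixed A.α₁ A.α₂ A.α₃ :=
  (fun j => A.cols₁.get j i, fun j => A.cols₂.get j i, fun j => A.cols₃.get j i)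

/-- The additive code generated by the rows. -/
def code (A : GenMatrix r) : AddSubgroup (Mixed A.α₁ A.α₂ A.α₃) :=
  AddSubgroup.closure (Set.range A.row)

end GenMatrix

/-- All `k`-tuples with entries from the list `S`, in lexicographic order. -/
def tuples {R : Type*} (S : List R) : (k : ℕ) → List (Fin k → R)
  | 0 => [Fin.elim0]
  | k + 1 => S.flatMap fun a => (tuples S k).map fun z => Fin.cons (α := fun _ => R) a z

/-- The block `cols` with the constant row `(a, …, a)` put below it. -/
def below {R : Type*} {r : ℕ} (a : R) (cols : List (Fin r → R)) : List (Fin (r + 1) → R) :=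
  cols.map fun z => Fin.snoc (α := fun _ => R) z a

/-- For every `a` in the list `S`, in turn, a copy of the block `cols` with `(a, …, a)` below it. -/
def copies {R : Type*} {r : ℕ} (S : List R) (cols : List (Fin r → R)) :
    List (Fin (r + 1) → R) :=
  S.flatMap fun a => below a cols

/-- The matrix `M₁`: its columns are the elements of `{2} × {0, 2}^k` over `ℤ₄`. -/
def M₁ (k : ℕ) : List (Fin (k + 1) → ZMod 4) :=
  (tuples [0, 2] k).map fun z => Fin.cons (α := fun _ => ZMod 4) 2 z

/-- The matrix `M₂`: its columns are the elements of `{4} × {0, 2, 4, 6}^k` over `ℤ₈`. -/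
def M₂ (k : ℕ) : List (Fin (k + 1) → ZMod 8) :=
  (tuples [0, 2, 4, 6] k).map fun z => Fin.cons (α := fun _ => ZMod 8) 4 z

/-- The matrix `A^{1,0,1}`, with the rows `(1 1 ∣ 2 ∣ 4)` and `(0 1 ∣ 1 ∣ 1)`. -/
def base : GenMatrix 2 where
  cols₁ := [![1, 0], ![1, 1]]
  cols₂ := [![2, 1]]
  cols₃ := [![4, 1]]

/-- The step that adds a row of order 8. -/
def step8 {k : ℕ} (A : GenMatrix (k + 1)) : GenMatrix (k + 1 + 1) where
  cols₁ := copies [0, 1] A.cols₁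
  cols₂ := below 1 (M₁ k) ++ copies [0, 1, 2, 3] A.cols₂
  cols₃ := below 1 (M₂ k) ++ copies [0, 1, 2, 3, 4, 5, 6, 7] A.cols₃

/-- The step that adds a row of order 4. -/
def step4 {k : ℕ} (A : GenMatrix (k + 1)) : GenMatrix (k + 1 + 1) where
  cols₁ := copies [0, 1] A.cols₁
  cols₂ := below 1 (M₁ k) ++ copies [0, 1, 2, 3] A.cols₂
  cols₃ := copies [0, 2, 4, 6] A.cols₃

/-- The step that adds a row of order 2. -/
def step2 {k : ℕ} (A : GenMatrix (k + 1)) : GenMatrix (k + 1 + 1) where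
  cols₁ := copies [0, 1] A.cols₁
  cols₂ := copies [0, 2] A.cols₂
  cols₃ := copies [0, 4] A.cols₃

/-- The matrix `A^{1 + a, 0, 1}`. -/
def matrix8 : (a : ℕ) → GenMatrix (a + 1 + 1)
  | 0 => base
  | a + 1 => step8 (matrix8 a)

/-- The matrix `A^{1 + a, b, 1}`. -/
def matrix84 (a : ℕ) : (b : ℕ) → GenMatrix (a + b + 1 + 1)
  | 0 => matrix8 a
  | b + 1 => step4 (matrix84 a b)

/-- The matrix `A^{1 + a, b, 1 + c}`. -/
def matrix842 (a b : ℕ) : (c : ℕ) → GenMatrix (a + b + c + 1 + 1)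
  | 0 => matrix84 a b
  | c + 1 => step2 (matrix842 a b c)

/-- The matrix `A^{t₁,t₂,t₃}`, for `t₁ ≥ 1`, `t₂ ≥ 0` and `t₃ ≥ 1`. -/
def genMatrix (t₁ t₂ t₃ : ℕ) : GenMatrix (t₁ - 1 + t₂ + (t₃ - 1) + 1 + 1) :=
  matrix842 (t₁ - 1) t₂ (t₃ - 1)

/-- The additive Hadamard code `𝓗^{t₁,t₂,t₃}`, generated by the rows of `A^{t₁,t₂,t₃}`. -/
def hadamardCode (t₁ t₂ t₃ : ℕ) :
    AddSubgroup (Mixed (genMatrix t₁ t₂ t₃).α₁ (genMatrix t₁ t₂ t₃).α₂ (genMatrix t₁ t₂ t₃).α₃) :=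
  (genMatrix t₁ t₂ t₃).code

/-- The Gray image `Φ(H)` of an additive code. -/
def grayImage {α₁ α₂ α₃ : ℕ} (H : AddSubgroup (Mixed α₁ α₂ α₃)) :
    Set (Place α₁ α₂ α₃ → ZMod 2) :=
  Gray '' (H : Set (Mixed α₁ α₂ α₃))

/-- The codewords of order at most two of an additive code. -/
def orderAtMostTwo {α₁ α₂ α₃ : ℕ} (H : AddSubgroup (Mixed α₁ α₂ α₃)) :
    Set (Mixed α₁ α₂ α₃) :=
  {u | u ∈ H ∧ addOrderOf u ≤ 2}

end Z2Z4Z8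

/-!
# The kernel of the Gray image of an additive Hadamard code

On a single coordinate the Gray map is injective and linear in the binary digits, so `Φ(u) + Φ(v)
= Φ(u + v - 2 (u ∧ v))`, where `u ∧ v` is the coordinatewise and digitwise product
(`gray_two_add`, `gray_three_add`). Hence `Φ(u)` lies in the kernel of `Φ(𝓗)` exactly when `u`
lies in `𝓗` and the correction `2 (u ∧ v)` lies in `𝓗` for all `v` in `𝓗`. If `u` has order at
most two, the correction vanishes.

Codewords are linear forms with integer coefficients evaluated at the columns of the generator
matrix, and these columns are known explicitly: row 0 is `(1 ∣ 2 ∣ 4)`, and the rest of a column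
over `ℤ₄` or `ℤ₈` is a vector whose first odd entry is 1 (`hasColumns_matrix842`). Let `m` be the
number of rows of order 4 or 8.

If `m = 1`, the only row of order above two is constantly 1 over `ℤ₄` and `ℤ₈`, every correction
is a multiple of it, and `Φ(𝓗)` is linear (`isLinearCode_grayImage`).

If `m ≥ 2`, let `l` be the linear form of a kernel element. Over `ℤ₄` the correction is twice a
product of two forms modulo 2, and a product of two independent linear forms is not linear; so `l`
has even coefficients at all rows of order 4 or 8 (`even_coeff_of_kernel`). Over `ℤ₈` the
correction is then `4` times the product of `l / 2` with the middle digit of `v`. The middle digit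
of a row changes when the column entry changes by 2, but the correction, as a linear form with
coefficients divisible by 4, does not; so `l / 2` is even at the rows of order 8
(`four_dvd_coeff_of_kernel`). These two facts say that the codeword has order at most two. Both
steps compare values at a few columns, described in the docstrings by their entries below row 0,
with `eᵢ` for the `i`-th unit vector.
-/

namespace Z2Z4Z8

/-! ### The Gray map -/

/-- `φ₂` is linear in the binary digits, so a sum of images is the image of the digitwise sum
`u + v - 2 (u ∧ v)`; modulo 4 the digitwise product satisfies `2 (u ∧ v) = 2 u v`. -/
theorem gray_two_add (u v : ZMod 4) (k : Fin 2) :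
    gray 2 u k + gray 2 v k = gray 2 (u + v - 2 * u * v : ZMod 4) k := by
  revert u v k; decide +kernel

theorem gray_two_injective {u v : ZMod 4} (h : ∀ k : Fin 2, gray 2 u k = gray 2 v k) : u = v := by
  revert u v; decide +kernel

/-- `φ₃` is linear in the binary digits, so a sum of images is the image of the digitwise sum
`u + v - 2 (u ∧ v)`, where `∧` multiplies the digits place by place. -/
theorem gray_three_add (u v : ZMod 8) (k : Fin 4) :
    gray 3 u k + gray 3 v k = gray 3 (u + v - 2 * ((u.val &&& v.val : ℕ) : ZMod 8) : ZMod 8) k := by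
  revert u v k; decide +kernel

theorem gray_three_injective {u v : ZMod 8} (h : ∀ k : Fin 4, gray 3 u k = gray 3 v k) :
    u = v := by
  revert u v; decide +kernel

theorem two_mul_land_of_two_mul_eq_zero {u : ZMod 8} (hu : 2 * u = 0) (v : ZMod 8) :
    2 * ((u.val &&& v.val : ℕ) : ZMod 8) = 0 := by
  revert u v; decide +kernel

/-- If `u ∈ {2, 6}`, then `2 (u ∧ v)` is four times the middle digit of `v`, and that is the value
of the polynomial `2 v (v - 1)`. -/
theorem two_mul_land_of_two_mul_eq_four {u : ZMod 8} (hu : 2 * u = 4) (v : ZMod 8) :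
    2 * ((u.val &&& v.val : ℕ) : ZMod 8) = 2 * v * (v - 1) := by
  revert u v; decide +kernel

/-- Only the digits of weight 1 and 2 matter for `2 (u ∧ v)` modulo 8, and these are determined by
`2 u` and `2 v`. -/
theorem two_mul_land_congr {u k : ZMod 8} (hu : 2 * u = 2 * k) {v l : ZMod 8}
    (hv : 2 * v = 2 * l) :
    2 * ((u.val &&& v.val : ℕ) : ZMod 8) = 2 * ((k.val &&& l.val : ℕ) : ZMod 8) := by
  revert u k v l; decide +kernel

/-- The analogue modulo 4 of `two_mul_land_congr`, for elements of `ℤ₈` reduced to `ℤ₄`. -/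
theorem two_mul_land_cast (k l : ZMod 8) :
    2 * ((k.val &&& l.val : ℕ) : ZMod 4) = 2 * (k.cast : ZMod 4) * (l.cast : ZMod 4) := by
  revert k l; decide +kernel

theorem Gray_zero {α₁ α₂ α₃ : ℕ} : Gray (0 : Mixed α₁ α₂ α₃) = 0 := by
  funext k
  rcases k with j | ⟨j, k⟩ | ⟨j, k⟩
  · rfl
  · have : ∀ k : Fin 2, gray 2 (0 : ZMod 4) k = 0 := by decide +kernel
    exact this k
  · have : ∀ k : Fin 4, gray 3 (0 : ZMod 8) k = 0 := by decide +kernel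
    exact this k

theorem Gray_add_of_two_nsmul_eq_zero {α₁ α₂ α₃ : ℕ} {u : Mixed α₁ α₂ α₃} (hu : 2 • u = 0)
    (v : Mixed α₁ α₂ α₃) : Gray u + Gray v = Gray (u + v) := by
  funext k
  rcases k with j | ⟨j, k⟩ | ⟨j, k⟩
  · rfl
  · have h : 2 * u.2.1 j = 0 := by
      simpa [two_mul, two_nsmul] using congrFun (congrArg (fun w => w.2.1) hu) j
    have := gray_two_add (u.2.1 j) (v.2.1 j) k
    rw [h, zero_mul, sub_zero] at this
    exact this
  · have h : 2 * u.2.2 j = 0 := by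
      simpa [two_mul, two_nsmul] using congrFun (congrArg (fun w => w.2.2) hu) j
    have := gray_three_add (u.2.2 j) (v.2.2 j) k
    rw [two_mul_land_of_two_mul_eq_zero h, sub_zero] at this
    exact this

/-! ### Columns of the generator matrices -/

/-- The columns over `ℤ₄`: the entry in row 0 is 2, the rows after the `m`-th have even entries, and
among the rows `1, …, m` there is one with entry 1 preceded only by even entries. Evenness is
written `2 * x = 0`. -/
def IsColumn₄ {k : ℕ} (m : ℕ) (z : Fin (k + 1) → ZMod 4) : Prop :=
  z 0 = 2 ∧ (∀ i : Fin (k + 1), m < i.val → 2 * z i = 0) ∧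
    ∃ i : Fin (k + 1), 0 < i.val ∧ i.val ≤ m ∧ z i = 1 ∧
      ∀ j : Fin (k + 1), 0 < j.val → j < i → 2 * z j = 0

/-- The columns over `ℤ₈`: the entry in row 0 is 4, rows `1, …, p` have an entry 1 preceded only by
even entries, the rows after the `p`-th have even entries, and those after the `m`-th have entries
in `{0, 4}`. Evenness is written `4 * x = 0`, and membership in `{0, 4}` is written `2 * x = 0`. -/
def IsColumn₈ {k : ℕ} (p m : ℕ) (z : Fin (k + 1) → ZMod 8) : Prop :=
  z 0 = 4 ∧ (∀ i : Fin (k + 1), p < i.val → 4 * z i = 0) ∧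
    (∀ i : Fin (k + 1), m < i.val → 2 * z i = 0) ∧
    ∃ i : Fin (k + 1), 0 < i.val ∧ i.val ≤ p ∧ z i = 1 ∧
      ∀ j : Fin (k + 1), 0 < j.val → j < i → 4 * z j = 0

theorem mem_tuples {R : Type*} {S : List R} {k : ℕ} {z : Fin k → R} :
    z ∈ tuples S k ↔ ∀ i, z i ∈ S := by
  induction k with
  | zero => simp [tuples, Subsingleton.elim z Fin.elim0]
  | succ k ih =>
    simp only [tuples, List.mem_flatMap, List.mem_map, ih, Fin.forall_fin_succ]
    constructor
    · rintro ⟨a, ha, w, hw, rfl⟩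
      simpa using ⟨ha, hw⟩
    · rintro ⟨h0, h⟩
      exact ⟨z 0, h0, Fin.tail z, h, Fin.cons_self_tail z⟩

theorem mem_below {R : Type*} {r : ℕ} {a : R} {cols : List (Fin r → R)} {z : Fin (r + 1) → R} :
    z ∈ below a cols ↔ z (Fin.last r) = a ∧ Fin.init z ∈ cols := by
  simp only [below, List.mem_map]
  constructor
  · rintro ⟨w, hw, rfl⟩
    simpa using hw
  · rintro ⟨rfl, h⟩
    exact ⟨_, h, Fin.snoc_init_self z⟩

theorem mem_copies {R : Type*} {r : ℕ} {S : List R} {cols : List (Fin r → R)}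
    {z : Fin (r + 1) → R} :
    z ∈ copies S cols ↔ z (Fin.last r) ∈ S ∧ Fin.init z ∈ cols := by
  simp [copies, mem_below]

theorem mem_cons_tuples {R : Type*} {S : List R} {k : ℕ} {a : R} {z : Fin (k + 1) → R} :
    z ∈ (tuples S k).map (fun w => Fin.cons (α := fun _ => R) a w) ↔
      z 0 = a ∧ ∀ i : Fin (k + 1), 0 < i.val → z i ∈ S := by
  simp only [List.mem_map, mem_tuples, Fin.forall_fin_succ (n := k)]
  constructor
  · rintro ⟨w, hw, rfl⟩
    simpa using hw
  · rintro ⟨rfl, -, h⟩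
    exact ⟨Fin.tail z, fun i => h i (by simp), Fin.cons_self_tail z⟩

theorem mem_zero_two {x : ZMod 4} : x ∈ [(0 : ZMod 4), 2] ↔ 2 * x = 0 := by
  revert x; decide +kernel

theorem mem_zero_four {x : ZMod 8} : x ∈ [(0 : ZMod 8), 4] ↔ 2 * x = 0 := by
  revert x; decide +kernel

theorem mem_evens {x : ZMod 8} : x ∈ [(0 : ZMod 8), 2, 4, 6] ↔ 4 * x = 0 := by
  revert x; decide +kernel

theorem mem_all_two (x : ZMod 2) : x ∈ [(0 : ZMod 2), 1] := by
  revert x; decide +kernel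

theorem mem_all_four (x : ZMod 4) : x ∈ [(0 : ZMod 4), 1, 2, 3] := by
  revert x; decide +kernel

theorem mem_all_eight (x : ZMod 8) : x ∈ [(0 : ZMod 8), 1, 2, 3, 4, 5, 6, 7] := by
  revert x; decide +kernel

theorem mem_M₁ {k : ℕ} {z : Fin (k + 1) → ZMod 4} :
    z ∈ M₁ k ↔ z 0 = 2 ∧ ∀ i : Fin (k + 1), 0 < i.val → 2 * z i = 0 := by
  simp only [M₁, mem_cons_tuples, mem_zero_two]

theorem mem_M₂ {k : ℕ} {z : Fin (k + 1) → ZMod 8} :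
    z ∈ M₂ k ↔ z 0 = 4 ∧ ∀ i : Fin (k + 1), 0 < i.val → 4 * z i = 0 := by
  simp only [M₂, mem_cons_tuples, mem_evens]

/-- A new row of order 4 or 8 either holds the first odd entry, which is 1, below even entries, or
stands freely below a column that already has an odd entry. -/
theorem isColumn₄_append {k : ℕ} {z : Fin (k + 1 + 1) → ZMod 4} :
    IsColumn₄ (k + 1) z ↔
      (z (Fin.last (k + 1)) = 1 ∧ Fin.init z ∈ M₁ k) ∨ IsColumn₄ k (Fin.init z) := by
  have h0 : z 0 = Fin.init z 0 := rfl
  simp only [IsColumn₄, mem_M₁, h0]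
  constructor
  · rintro ⟨hz, -, i, hi, him, hzi, hj⟩
    induction i using Fin.lastCases with
    | last => exact Or.inl ⟨hzi, hz, fun j hj0 => hj j.castSucc hj0 (Fin.castSucc_lt_last j)⟩
    | cast i =>
      exact Or.inr ⟨hz, fun j hj => by omega, i, hi, by omega, hzi,
        fun j hj0 hji => hj j.castSucc hj0 hji⟩
  · rintro (⟨hz, hz0, hj⟩ | ⟨hz, -, i, hi, him, hzi, hj⟩)
    · refine ⟨hz0, fun j hj => by omega, Fin.last _, by simp, by simp, hz, fun j hj0 hjl => ?_⟩
      exact hj (j.castLT hjl) hj0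
    · refine ⟨hz, fun j hj => by omega, i.castSucc, hi,
        Nat.le_succ_of_le him, hzi, fun j hj0 hjl => ?_⟩
      exact hj (j.castLT (hjl.trans (Fin.castSucc_lt_last i))) hj0 hjl

/-- The analogue over `ℤ₈` of `isColumn₄_append`, for a new row of order 8. -/
theorem isColumn₈_append {k : ℕ} {z : Fin (k + 1 + 1) → ZMod 8} :
    IsColumn₈ (k + 1) (k + 1) z ↔
      (z (Fin.last (k + 1)) = 1 ∧ Fin.init z ∈ M₂ k) ∨ IsColumn₈ k k (Fin.init z) := by
  have h0 : z 0 = Fin.init z 0 := rfl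
  simp only [IsColumn₈, mem_M₂, h0]
  constructor
  · rintro ⟨hz, -, -, i, hi, him, hzi, hj⟩
    induction i using Fin.lastCases with
    | last => exact Or.inl ⟨hzi, hz, fun j hj0 => hj j.castSucc hj0 (Fin.castSucc_lt_last j)⟩
    | cast i =>
      exact Or.inr ⟨hz, fun j hj => by omega, fun j hj => by omega, i, hi, by omega, hzi,
        fun j hj0 hji => hj j.castSucc hj0 hji⟩
  · rintro (⟨hz, hz0, hj⟩ | ⟨hz, -, -, i, hi, him, hzi, hj⟩)
    · refine ⟨hz0, fun j hj => by omega, fun j hj => by omega, Fin.last _, by simp, by simp, hz,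
        fun j hj0 hjl => ?_⟩
      exact hj (j.castLT hjl) hj0
    · refine ⟨hz, fun j hj => by omega, fun j hj => by omega, i.castSucc, hi,
        Nat.le_succ_of_le him, hzi, fun j hj0 hjl => ?_⟩
      exact hj (j.castLT (hjl.trans (Fin.castSucc_lt_last i))) hj0 hjl

theorem isColumn₄_extend {k m : ℕ} (hm : m ≤ k) {z : Fin (k + 1 + 1) → ZMod 4} :
    IsColumn₄ m z ↔ 2 * z (Fin.last (k + 1)) = 0 ∧ IsColumn₄ m (Fin.init z) := by
  have h0 : z 0 = Fin.init z 0 := rfl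
  simp only [IsColumn₄, h0]
  constructor
  · rintro ⟨hz, hm', i, hi, him, hzi, hj⟩
    refine ⟨hm' _ (by simp; omega), hz, fun j => hm' j.castSucc, i.castLT (by omega), hi, him, hzi,
      fun j hj0 hji => hj j.castSucc hj0 hji⟩
  · rintro ⟨hl, hz, hm', i, hi, him, hzi, hj⟩
    refine ⟨hz, fun j hjm => ?_, i.castSucc, hi, him, hzi, fun j hj0 hjl =>
      hj (j.castLT (hjl.trans (Fin.castSucc_lt_last i))) hj0 hjl⟩
    induction j using Fin.lastCases with
    | last => exact hl
    | cast j => exact hm' j hjm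

/-- A new row of order 4 or 2 is even over `ℤ₈`, so the first odd entry stays where it was. -/
theorem isColumn₈_extend {k p m : ℕ} (hp : p ≤ k) {z : Fin (k + 1 + 1) → ZMod 8} :
    IsColumn₈ p m z ↔ (4 * z (Fin.last (k + 1)) = 0 ∧
      (m < k + 1 → 2 * z (Fin.last (k + 1)) = 0)) ∧ IsColumn₈ p m (Fin.init z) := by
  have h0 : z 0 = Fin.init z 0 := rfl
  simp only [IsColumn₈, h0]
  constructor
  · rintro ⟨hz, hp', hm', i, hi, him, hzi, hj⟩
    refine ⟨⟨hp' _ (by simp; omega), fun h => hm' _ (by simpa using h)⟩, hz,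
      fun j => hp' j.castSucc, fun j => hm' j.castSucc, i.castLT (by omega), hi, him, hzi,
      fun j hj0 hji => hj j.castSucc hj0 hji⟩
  · rintro ⟨⟨hl, hl'⟩, hz, hp', hm', i, hi, him, hzi, hj⟩
    refine ⟨hz, fun j hjm => ?_, fun j hjm => ?_, i.castSucc, hi, him, hzi, fun j hj0 hjl =>
      hj (j.castLT (hjl.trans (Fin.castSucc_lt_last i))) hj0 hjl⟩
    · induction j using Fin.lastCases with
      | last => exact hl
      | cast j => exact hp' j hjm
    · induction j using Fin.lastCases with
      | last => exact hl' (by simpa using hjm)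
      | cast j => exact hm' j hjm

/-- The matrix `A` has exactly the columns of a generator matrix whose rows `1, …, p` have order 8
and whose rows `p + 1, …, m` have order 4, the later rows and row 0 having order 2. Multiplicity
and order of the columns are disregarded. -/
structure HasColumns {k : ℕ} (A : GenMatrix (k + 1)) (p m : ℕ) : Prop where
  mem_cols₁ : ∀ z, z ∈ A.cols₁ ↔ z 0 = 1
  mem_cols₂ : ∀ z, z ∈ A.cols₂ ↔ IsColumn₄ m z
  mem_cols₃ : ∀ z, z ∈ A.cols₃ ↔ IsColumn₈ p m z

theorem hasColumns_base : HasColumns base 1 1 where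
  mem_cols₁ := by decide +kernel
  mem_cols₂ := by unfold IsColumn₄; decide +kernel
  mem_cols₃ := by unfold IsColumn₈; decide +kernel

theorem HasColumns.step8 {k : ℕ} {A : GenMatrix (k + 1)} (h : HasColumns A k k) :
    HasColumns (step8 A) (k + 1) (k + 1) where
  mem_cols₁ z := by
    simp only [Z2Z4Z8.step8, mem_copies, h.mem_cols₁, mem_all_two, true_and]; rfl
  mem_cols₂ z := by
    simp only [Z2Z4Z8.step8, List.mem_append, mem_below, mem_copies, h.mem_cols₂, mem_all_four,
      true_and, isColumn₄_append]
  mem_cols₃ z := by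
    simp only [Z2Z4Z8.step8, List.mem_append, mem_below, mem_copies, h.mem_cols₃, mem_all_eight,
      true_and, isColumn₈_append]

/-- The bound `m` is void once it reaches the number of the last row. -/
theorem isColumn₈_iff_of_le {k p m : ℕ} (hm : k ≤ m) {z : Fin (k + 1) → ZMod 8} :
    IsColumn₈ p m z ↔ IsColumn₈ p k z := by
  have h (n : ℕ) (hn : k ≤ n) : (∀ i : Fin (k + 1), n < i.val → 2 * z i = 0) ↔ True :=
    iff_true_intro fun i hi => absurd i.isLt (by omega)
  simp only [IsColumn₈, h m hm, h k le_rfl]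

theorem HasColumns.step4 {k p : ℕ} {A : GenMatrix (k + 1)} (hp : p ≤ k) (h : HasColumns A p k) :
    HasColumns (step4 A) p (k + 1) where
  mem_cols₁ z := by
    simp only [Z2Z4Z8.step4, mem_copies, h.mem_cols₁, mem_all_two, true_and]; rfl
  mem_cols₂ z := by
    simp only [Z2Z4Z8.step4, List.mem_append, mem_below, mem_copies, h.mem_cols₂, mem_all_four,
      true_and, isColumn₄_append]
  mem_cols₃ z := by
    simp [Z2Z4Z8.step4, -List.mem_cons, mem_copies, h.mem_cols₃, mem_evens, isColumn₈_extend hp,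
      isColumn₈_iff_of_le (Nat.le_succ k)]

theorem HasColumns.step2 {k p m : ℕ} {A : GenMatrix (k + 1)} (hp : p ≤ k) (hm : m ≤ k)
    (h : HasColumns A p m) : HasColumns (step2 A) p m where
  mem_cols₁ z := by
    simp only [Z2Z4Z8.step2, mem_copies, h.mem_cols₁, mem_all_two, true_and]; rfl
  mem_cols₂ z := by
    simp only [Z2Z4Z8.step2, mem_copies, h.mem_cols₂, mem_zero_two, isColumn₄_extend hm]
  mem_cols₃ z := by
    have h4 (x : ZMod 8) : 2 * x = 0 ↔ 4 * x = 0 ∧ 2 * x = 0 := by revert x; decide +kernel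
    simp only [Z2Z4Z8.step2, mem_copies, h.mem_cols₃, mem_zero_four, isColumn₈_extend hp,
      Nat.lt_succ_of_le hm, true_imp_iff, ← h4]

theorem hasColumns_matrix8 (a : ℕ) : HasColumns (matrix8 a) (a + 1) (a + 1) := by
  induction a with
  | zero => exact hasColumns_base
  | succ a ih => exact ih.step8

theorem hasColumns_matrix84 (a b : ℕ) : HasColumns (matrix84 a b) (a + 1) (a + b + 1) := by
  induction b with
  | zero => exact hasColumns_matrix8 a
  | succ b ih => exact ih.step4 (by omega)

theorem hasColumns_matrix842 (a b c : ℕ) :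
    HasColumns (matrix842 a b c) (a + 1) (a + b + 1) := by
  induction c with
  | zero => exact hasColumns_matrix84 a b
  | succ c ih => exact ih.step2 (by omega) (by omega)

/-! ### Codewords as linear forms in the columns -/

/-- The value of the linear form with integer coefficients `l` at the column `z`. -/
def evalAt {R : Type*} [CommRing R] {r : ℕ} (l : Fin r → ℤ) (z : Fin r → R) : R :=
  ∑ i, (l i : R) * z i

theorem evalAt_single_one {R : Type*} [CommRing R] {r : ℕ} (i : Fin r) (z : Fin r → R) :
    evalAt (Pi.single i 1) z = z i := by
  simp [evalAt, Pi.single_apply]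

theorem evalAt_single {R : Type*} [CommRing R] {r : ℕ} (l : Fin r → ℤ) (i : Fin r) (c : R) :
    evalAt l (Pi.single i c) = l i * c := by
  simp [evalAt, Pi.single_apply]

theorem evalAt_add {R : Type*} [CommRing R] {r : ℕ} (l : Fin r → ℤ) (z w : Fin r → R) :
    evalAt l (z + w) = evalAt l z + evalAt l w := by
  simp [evalAt, mul_add, Finset.sum_add_distrib]

theorem two_mul_evalAt {R : Type*} [CommRing R] {r : ℕ} (l : Fin r → ℤ) {z : Fin r → R}
    {i : Fin r} (hi : z i = 1) (h : ∀ j ≠ i, 2 * z j = 0) : 2 * evalAt l z = 2 * (l i : R) := by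
  rw [evalAt, Finset.mul_sum, Finset.sum_eq_single i, hi, mul_one]
  · intro j _ hj
    rw [mul_left_comm, h j hj, mul_zero]
  · simp

theorem evalAt_add_evalAt_eq_zero {R : Type*} [CommRing R] {r : ℕ} {l : Fin r → ℤ}
    {z : Fin r → R} (h : ∀ i, (l i : R) * (2 * z i) = 0) : evalAt l z + evalAt l z = 0 := by
  rw [← two_mul, evalAt, Finset.mul_sum]
  exact Finset.sum_eq_zero fun i _ => by rw [mul_left_comm, h i]

/-- The integral combination of the rows of `A` with coefficients `l`: its coordinates are the
values of the linear form `l` at the columns of `A`. -/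
def codeword {r : ℕ} (A : GenMatrix r) (l : Fin r → ℤ) : Mixed A.α₁ A.α₂ A.α₃ :=
  (fun j => evalAt l (A.cols₁.get j), fun j => evalAt l (A.cols₂.get j),
    fun j => evalAt l (A.cols₃.get j))

theorem codeword_eq_sum {r : ℕ} (A : GenMatrix r) (l : Fin r → ℤ) :
    codeword A l = ∑ i, l i • A.row i := by
  simp only [codeword, evalAt, GenMatrix.row]
  refine Prod.ext ?_ (Prod.ext ?_ ?_) <;> funext j <;>
    simp [Prod.fst_sum, Prod.snd_sum]

theorem mem_code_iff {r : ℕ} {A : GenMatrix r} {u : Mixed A.α₁ A.α₂ A.α₃} :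
    u ∈ A.code ↔ ∃ l, codeword A l = u := by
  simp only [codeword_eq_sum]
  rw [← Submodule.mem_span_range_iff_exists_fun ℤ, GenMatrix.code,
    ← Submodule.span_int_eq_addSubgroupClosure, Submodule.mem_toAddSubgroup]

/-- If the sum of the Gray images of two codewords lies in the Gray image of the code, then the
coordinatewise correction `2 (u ∧ v)` is itself a codeword, given by a linear form `d`. Over `ℤ₈`
its value is recorded only where the first codeword is 2 or 6. -/
theorem exists_form_of_gray_add_mem {r : ℕ} {A : GenMatrix r} {l n : Fin r → ℤ}
    (h : Gray (codeword A l) + Gray (codeword A n) ∈ grayImage A.code) :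
    ∃ d : Fin r → ℤ, (∀ z ∈ A.cols₁, evalAt d z = 0) ∧
      (∀ z ∈ A.cols₂, evalAt d z = 2 * evalAt l z * evalAt n z) ∧
      (∀ z ∈ A.cols₃, 2 * evalAt l z = 4 → evalAt d z = 2 * evalAt n z * (evalAt n z - 1)) := by
  obtain ⟨x, hx, hGx⟩ := h
  have hy : codeword A l + codeword A n - x ∈ A.code :=
    sub_mem (add_mem (mem_code_iff.2 ⟨l, rfl⟩) (mem_code_iff.2 ⟨n, rfl⟩)) hx
  obtain ⟨d, hd⟩ := mem_code_iff.1 hy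
  refine ⟨d, fun z hz => ?_, fun z hz => ?_, fun z hz h4 => ?_⟩
  · obtain ⟨j, rfl⟩ := List.mem_iff_get.1 hz
    have h1 := congrFun hGx (.inl j)
    have h2 : evalAt d (A.cols₁.get j) =
        evalAt l (A.cols₁.get j) + evalAt n (A.cols₁.get j) - x.1 j :=
      congrFun (congrArg (fun w => w.1) hd) j
    rw [h2, show x.1 j = evalAt l (A.cols₁.get j) + evalAt n (A.cols₁.get j) from h1, sub_self]
  · obtain ⟨j, rfl⟩ := List.mem_iff_get.1 hz
    have h2 : evalAt d (A.cols₂.get j) =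
        evalAt l (A.cols₂.get j) + evalAt n (A.cols₂.get j) - x.2.1 j :=
      congrFun (congrArg (fun w => w.2.1) hd) j
    have h1 := gray_two_injective fun k =>
      (congrFun hGx (.inr (.inl (j, k)))).trans (gray_two_add _ _ k)
    rw [h2, h1]
    exact sub_sub_cancel _ _
  · obtain ⟨j, rfl⟩ := List.mem_iff_get.1 hz
    have h2 : evalAt d (A.cols₃.get j) =
        evalAt l (A.cols₃.get j) + evalAt n (A.cols₃.get j) - x.2.2 j :=
      congrFun (congrArg (fun w => w.2.2) hd) j
    have h1 := gray_three_injective fun k =>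
      (congrFun hGx (.inr (.inr (j, k)))).trans (gray_three_add _ _ k)
    rw [h2, h1, ← two_mul_land_of_two_mul_eq_four h4]
    exact sub_sub_cancel _ _

/-! ### The kernel -/

theorem addOrderOf_le_two_iff {α₁ α₂ α₃ : ℕ} {u : Mixed α₁ α₂ α₃} :
    addOrderOf u ≤ 2 ↔ 2 • u = 0 := by
  refine ⟨fun h => ?_, addOrderOf_le_of_nsmul_eq_zero (by norm_num)⟩
  have hpos := addOrderOf_pos u
  rw [← addOrderOf_dvd_iff_nsmul_eq_zero]
  interval_cases addOrderOf u <;> norm_num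

/-- Translation by the Gray image of a codeword of order at most two corresponds to translation in
the additive code, so it preserves the Gray image of the code. -/
theorem grayImage_orderAtMostTwo_subset {α₁ α₂ α₃ : ℕ} (H : AddSubgroup (Mixed α₁ α₂ α₃)) :
    Gray '' orderAtMostTwo H ⊆ codeKernel (grayImage H) := by
  rintro _ ⟨u, ⟨hu, hu2⟩, rfl⟩
  have h2 := addOrderOf_le_two_iff.1 hu2
  ext c
  constructor
  · rintro ⟨_, ⟨v, hv, rfl⟩, rfl⟩
    exact ⟨u + v, add_mem hu hv, (Gray_add_of_two_nsmul_eq_zero h2 v).symm⟩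
  · rintro ⟨v, hv, rfl⟩
    refine ⟨_, ⟨-u + v, add_mem (neg_mem hu) hv, rfl⟩, ?_⟩
    exact (Gray_add_of_two_nsmul_eq_zero h2 _).trans (by rw [add_neg_cancel_left])

theorem isLinearCode_of_add_mem {ι : Type*} {C : Set (ι → ZMod 2)} (h0 : 0 ∈ C)
    (hadd : ∀ x ∈ C, ∀ y ∈ C, x + y ∈ C) : IsLinearCode C := by
  refine ⟨⟨⟨⟨C, fun {x y} hx hy => hadd x hx y hy⟩, h0⟩, fun c x hx => ?_⟩, rfl⟩
  obtain rfl | rfl : c = 0 ∨ c = 1 := by revert c; decide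
  · rw [zero_smul]; exact h0
  · rw [one_smul]; exact hx

theorem IsColumn₄.one_eq {k : ℕ} {z : Fin (k + 1) → ZMod 4} (hz : IsColumn₄ 1 z)
    {i : Fin (k + 1)} (hi : i.val = 1) : z i = 1 ∧ ∀ j ≠ i, 2 * z j = 0 := by
  obtain ⟨h0, h2, n, hn, hn1, hzn, -⟩ := hz
  obtain rfl : n = i := Fin.ext (by omega)
  refine ⟨hzn, fun j hj => ?_⟩
  obtain rfl | hj0 := eq_or_ne j 0
  · rw [h0]; rfl
  · have h1 := Fin.val_ne_of_ne hj
    have h3 : j.val ≠ 0 := Fin.val_ne_of_ne hj0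
    exact h2 j (by omega)

theorem IsColumn₈.one_eq {k : ℕ} {z : Fin (k + 1) → ZMod 8} (hz : IsColumn₈ 1 1 z)
    {i : Fin (k + 1)} (hi : i.val = 1) : z i = 1 ∧ ∀ j ≠ i, 2 * z j = 0 := by
  obtain ⟨h0, -, h2, n, hn, hn1, hzn, -⟩ := hz
  obtain rfl : n = i := Fin.ext (by omega)
  refine ⟨hzn, fun j hj => ?_⟩
  obtain rfl | hj0 := eq_or_ne j 0
  · rw [h0]; rfl
  · have h1 := Fin.val_ne_of_ne hj
    have h3 : j.val ≠ 0 := Fin.val_ne_of_ne hj0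
    exact h2 j (by omega)

/-- If row 1 is the only row of order above two, it is constantly 1 over `ℤ₄` and `ℤ₈`, and the
correction `2 (u ∧ v)` is a multiple of it. The Gray image is therefore closed under addition. -/
theorem isLinearCode_grayImage {k : ℕ} {A : GenMatrix (k + 1)} (hk : 0 < k)
    (hA : HasColumns A 1 1) : IsLinearCode (grayImage A.code) := by
  obtain ⟨i, hi⟩ : ∃ i : Fin (k + 1), i.val = 1 := ⟨⟨1, by omega⟩, rfl⟩
  refine isLinearCode_of_add_mem ⟨0, zero_mem _, Gray_zero⟩ ?_
  rintro _ ⟨_, hu, rfl⟩ _ ⟨_, hv, rfl⟩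
  obtain ⟨l, rfl⟩ := mem_code_iff.1 hu
  obtain ⟨n, rfl⟩ := mem_code_iff.1 hv
  -- The digitwise sum of the two codewords differs from their sum by `2 w` times row `i`.
  let w : ℕ := (l i : ZMod 8).val &&& (n i : ZMod 8).val
  refine ⟨codeword A l + codeword A n - (2 * w) • A.row i,
    sub_mem (add_mem hu hv) (nsmul_mem (AddSubgroup.subset_closure (Set.mem_range_self i)) _), ?_⟩
  funext q
  rcases q with j | ⟨j, q⟩ | ⟨j, q⟩
  · have h : ((2 * w : ℕ) : ZMod 2) = 0 := by
      rw [Nat.cast_mul]; exact mul_eq_zero_of_left rfl _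
    simp [Gray, codeword, GenMatrix.row, -Nat.cast_mul, h]
  · obtain ⟨h1, h2⟩ := ((hA.mem_cols₂ _).1 (List.get_mem A.cols₂ j)).one_eq hi
    have e := gray_two_add (evalAt l (A.cols₂.get j)) (evalAt n (A.cols₂.get j)) q
    have e3 : 2 * (w : ZMod 4) = 2 * l i * n i := by
      rw [two_mul_land_cast, ZMod.cast_intCast (by norm_num), ZMod.cast_intCast (by norm_num)]
    rw [two_mul_evalAt l h1 h2, mul_right_comm, two_mul_evalAt n h1 h2, mul_right_comm, ← e3] at e
    refine Eq.trans (congrArg (fun x => gray 2 x q) ?_) e.symm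
    simp [codeword, GenMatrix.row, h1, -List.get_eq_getElem]
  · obtain ⟨h1, h2⟩ := ((hA.mem_cols₃ _).1 (List.get_mem A.cols₃ j)).one_eq hi
    have e := gray_three_add (evalAt l (A.cols₃.get j)) (evalAt n (A.cols₃.get j)) q
    rw [two_mul_land_congr (two_mul_evalAt l h1 h2) (two_mul_evalAt n h1 h2)] at e
    refine Eq.trans (congrArg (fun x => gray 3 x q) ?_) e.symm
    simp [codeword, GenMatrix.row, h1, w, -List.get_eq_getElem]

section Obstruction

variable {k p m : ℕ} {A : GenMatrix (k + 1)}

/-- The correction vanishes over `ℤ₂`, which forces all its coefficients to be even. -/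
theorem even_of_evalAt_cols₁ (hA : HasColumns A p m) {d : Fin (k + 1) → ℤ}
    (hd : ∀ z ∈ A.cols₁, evalAt d z = 0) (i : Fin (k + 1)) : 2 ∣ d i := by
  have h0 := hd (Pi.single 0 1) ((hA.mem_cols₁ _).2 (by simp))
  rw [evalAt_single, mul_one] at h0
  apply (ZMod.intCast_zmod_eq_zero_iff_dvd (d i) 2).1
  by_cases hi : i = 0
  · rw [hi, h0]
  · have h1 := hd (Pi.single 0 1 + Pi.single i 1) ((hA.mem_cols₁ _).2 (by simp [Ne.symm hi]))
    simpa [evalAt_add, evalAt_single, h0] using h1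

theorem single_mem_cols₂ (hA : HasColumns A p m) {i : Fin (k + 1)} (hi : 0 < i.val)
    (him : i.val ≤ m) : Pi.single 0 2 + Pi.single i 1 ∈ A.cols₂ := by
  rw [hA.mem_cols₂]
  have h0 : i ≠ 0 := fun h => by simp [h] at hi
  refine ⟨by simp [h0.symm], fun j hj => ?_, i, hi, him, by simp [h0], fun j hj hji => ?_⟩
  · have : j ≠ i := fun h => by rw [h] at hj; omega
    have : j ≠ 0 := fun h => by simp [h] at hj
    simp [*]
  · have : j ≠ 0 := fun h => by simp [h] at hj
    simp [*, hji.ne]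

theorem single_add_single_mem_cols₂ (hA : HasColumns A p m) {i j : Fin (k + 1)} (hi : 0 < i.val)
    (hij : i < j) (hj : j.val ≤ m) :
    Pi.single 0 2 + Pi.single i 1 + Pi.single j 1 ∈ A.cols₂ := by
  rw [hA.mem_cols₂]
  have h0 : i ≠ 0 := fun h => by simp [h] at hi
  have h1 : j ≠ 0 := fun h => by simp [h] at hij
  refine ⟨by simp [h0.symm, h1.symm], fun n hn => ?_, i, hi, by omega,
    by simp [h0, hij.ne], fun n hn hni => ?_⟩
  · have : n ≠ i := fun h => by rw [h] at hn; omega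
    have : n ≠ j := fun h => by rw [h] at hn; omega
    have : n ≠ 0 := fun h => by simp [h] at hn
    simp [*]
  · have : n ≠ 0 := fun h => by simp [h] at hn
    simp [*, hni.ne, (hni.trans hij).ne]

theorem single_mem_cols₃ (hA : HasColumns A p m) {i : Fin (k + 1)} (hi : 0 < i.val)
    (hip : i.val ≤ p) (him : i.val ≤ m) : Pi.single 0 4 + Pi.single i 1 ∈ A.cols₃ := by
  rw [hA.mem_cols₃]
  have h0 : i ≠ 0 := fun h => by simp [h] at hi
  refine ⟨by simp [h0.symm], fun j hj => ?_, fun j hj => ?_, i, hi, hip, by simp [h0],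
    fun j hj hji => ?_⟩
  · have : j ≠ i := fun h => by rw [h] at hj; omega
    have : j ≠ 0 := fun h => by simp [h] at hj
    simp [*]
  · have : j ≠ i := fun h => by rw [h] at hj; omega
    have : j ≠ 0 := fun h => by simp [h] at hj
    simp [*]
  · have : j ≠ 0 := fun h => by simp [h] at hj
    simp [*, hji.ne]

/-- A zero entry of a column over `ℤ₈`, in a row of order 4 or 8, may be replaced by 2. -/
theorem add_two_mem_cols₃ (hA : HasColumns A p m) {z : Fin (k + 1) → ZMod 8} {j : Fin (k + 1)}
    (hj : 0 < j.val) (hjm : j.val ≤ m) (hz : z ∈ A.cols₃) (hzj : z j = 0) :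
    z + Pi.single j 2 ∈ A.cols₃ := by
  rw [hA.mem_cols₃] at hz ⊢
  obtain ⟨h0, hp, hm, i, hi, hip, hzi, hlt⟩ := hz
  have hj0 : j ≠ 0 := fun h => by simp [h] at hj
  have h4 (n : Fin (k + 1)) (h : 4 * z n = 0) :
      4 * (z + Pi.single j 2 : Fin (k + 1) → ZMod 8) n = 0 := by
    by_cases hn : n = j
    · subst hn
      simp only [Pi.add_apply, Pi.single_eq_same, mul_add, h]
      rfl
    · simpa [hn] using h
  have hij : i ≠ j := fun h => by
    rw [h, hzj] at hzi
    exact absurd hzi (by decide)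
  refine ⟨by simp [hj0.symm, h0], fun n hn => h4 n (hp n hn), fun n hn => ?_, i, hi, hip,
    by simp [hij, hzi], fun n hn hni => h4 n (hlt n hn hni)⟩
  have : n ≠ j := fun h => by rw [h] at hn; omega
  simpa [this] using hm n hn

theorem intCast_mul_two_eq_zero {d : ℤ} (hd : 2 ∣ d) : (d : ZMod 4) * 2 = 0 := by
  obtain ⟨e, he⟩ := hd
  rw [he]
  push_cast
  have : ∀ x : ZMod 4, 2 * x * 2 = 0 := by decide
  exact this _

theorem exists_ne_index (hm : 2 ≤ m) (hmk : m ≤ k) (i : Fin (k + 1)) :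
    ∃ j : Fin (k + 1), 0 < j.val ∧ j.val ≤ m ∧ i ≠ j := by
  by_cases h1 : i.val = 1
  · exact ⟨⟨2, by omega⟩, by simp, hm, fun h => by simp [h] at h1⟩
  · exact ⟨⟨1, by omega⟩, by simp, one_le_two.trans hm, fun h => h1 (by simp [h])⟩

/-- If `l` had an odd coefficient `l i`, the product of `l` with the coordinate form of another
row `j` would be a linear form modulo 2; comparing its values at `eᵢ`, `eⱼ` and `eᵢ + eⱼ` rules
this out. -/
theorem even_coeff_of_kernel (hA : HasColumns A p m) (hm : 2 ≤ m) (hmk : m ≤ k)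
    {l : Fin (k + 1) → ℤ}
    (hl : ∀ n, Gray (codeword A l) + Gray (codeword A n) ∈ grayImage A.code)
    {i : Fin (k + 1)} (hi : 0 < i.val) (him : i.val ≤ m) : 2 ∣ l i := by
  obtain ⟨j, hj, hjm, hij⟩ := exists_ne_index hm hmk i
  obtain ⟨d, hd₁, hd₂, -⟩ := exists_form_of_gray_add_mem (hl (Pi.single j 1))
  -- The entries 2 in row 0 of the columns do not contribute to the value of `d`.
  have hd0 := intCast_mul_two_eq_zero (even_of_evalAt_cols₁ hA hd₁ 0)
  have hj0 : j ≠ 0 := fun h => by simp [h] at hj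
  have e1 := hd₂ _ (single_mem_cols₂ hA hi him)
  have e2 := hd₂ _ (single_mem_cols₂ hA hj hjm)
  let z : Fin (k + 1) → ZMod 4 := Pi.single 0 2 + Pi.single i 1 + Pi.single j 1
  have e3 : evalAt d z = 2 * evalAt l z * evalAt (Pi.single j 1) z := by
    rcases lt_or_gt_of_ne hij with h | h
    · exact hd₂ _ (single_add_single_mem_cols₂ hA hi h hjm)
    · rw [show z = Pi.single 0 2 + Pi.single j 1 + Pi.single i 1 from add_right_comm _ _ _]
      exact hd₂ _ (single_add_single_mem_cols₂ hA hj h him)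
  simp [evalAt_add, evalAt_single, z, hd0, hij.symm, hj0] at e1 e2 e3
  have h : ((2 * l i : ℤ) : ZMod 4) = 0 := by
    push_cast
    linear_combination e1 + e2 - e3
  have := (ZMod.intCast_zmod_eq_zero_iff_dvd _ 4).1 h
  omega

/-- If `l i` is even, the correction vanishes over `ℤ₄` at the column `eᵢ`, so its `i`-th
coefficient is divisible by 4. -/
theorem four_dvd_of_evalAt_cols₂ (hA : HasColumns A p m) {d l n : Fin (k + 1) → ℤ}
    (hd₁ : ∀ z ∈ A.cols₁, evalAt d z = 0)
    (hd₂ : ∀ z ∈ A.cols₂, evalAt d z = 2 * evalAt l z * evalAt n z)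
    {i : Fin (k + 1)} (hi : 0 < i.val) (him : i.val ≤ m) (hl : 2 ∣ l i) : 4 ∣ d i := by
  have e := hd₂ _ (single_mem_cols₂ hA hi him)
  have h : 2 * evalAt l (Pi.single 0 2 + Pi.single i 1 : Fin (k + 1) → ZMod 4) = 0 := by
    obtain ⟨c, hc⟩ := hl
    simp only [evalAt_add, evalAt_single, hc]
    push_cast
    have : ∀ x y : ZMod 4, 2 * (x * 2 + 2 * y * 1) = 0 := by decide
    exact this _ _
  rw [h, zero_mul, evalAt_add, evalAt_single, evalAt_single,
    intCast_mul_two_eq_zero (even_of_evalAt_cols₁ hA hd₁ 0), zero_add, mul_one] at e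
  exact (ZMod.intCast_zmod_eq_zero_iff_dvd _ 4).1 e

/-- Suppose `l i ≡ 2` modulo 4 for a row `i` of order 8. With the `j`-th row as second codeword,
moving from the column `eᵢ` over `ℤ₈` to `eᵢ + 2 eⱼ` flips the middle digit of that codeword, so
the correction changes by 4; but it is a linear form whose `j`-th coefficient is divisible by 4.
-/
theorem four_dvd_coeff_of_kernel (hA : HasColumns A p m) (hm : 2 ≤ m) (hpm : p ≤ m) (hmk : m ≤ k)
    {l : Fin (k + 1) → ℤ}
    (hl : ∀ n, Gray (codeword A l) + Gray (codeword A n) ∈ grayImage A.code)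
    {i : Fin (k + 1)} (hi : 0 < i.val) (hip : i.val ≤ p) : 4 ∣ l i := by
  have heven {j : Fin (k + 1)} (hj : 0 < j.val) (hjm : j.val ≤ m) : 2 ∣ l j :=
    even_coeff_of_kernel hA hm hmk hl hj hjm
  obtain ⟨j, hj, hjm, hij⟩ := exists_ne_index hm hmk i
  obtain ⟨d, hd₁, hd₂, hd₃⟩ := exists_form_of_gray_add_mem (hl (Pi.single j 1))
  have hj0 : j ≠ 0 := fun h => by simp [h] at hj
  by_contra hli
  let z : Fin (k + 1) → ZMod 8 := Pi.single 0 4 + Pi.single i 1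
  have hz : z ∈ A.cols₃ := single_mem_cols₃ hA hi hip (hip.trans hpm)
  have hzj : z j = 0 := by simp [z, hj0, hij.symm]
  have hz' := add_two_mem_cols₃ hA hj hjm hz hzj
  have hlz : 2 * evalAt l z = 4 := by
    obtain ⟨c, hc⟩ := heven hi (hip.trans hpm)
    obtain ⟨e, rfl⟩ : ∃ e, c = 2 * e + 1 := ⟨c / 2, by omega⟩
    simp only [z, evalAt_add, evalAt_single, hc]
    push_cast
    have : ∀ x y : ZMod 8, 2 * (x * 4 + 2 * (2 * y + 1) * 1) = 4 := by decide +kernel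
    exact this _ _
  have hlz' : 2 * evalAt l (z + Pi.single j 2) = 4 := by
    obtain ⟨c, hc⟩ := heven hj hjm
    rw [evalAt_add, mul_add, hlz, evalAt_single, hc]
    push_cast
    have : ∀ x : ZMod 8, 4 + 2 * (2 * x * 2) = 4 := by decide
    exact this _
  have e := hd₃ z hz hlz
  have e' := hd₃ _ hz' hlz'
  -- Between the two columns the linear form `d` changes by `2 (d j) = 0`, whereas `2 v (v - 1)`
  -- changes from 0 to 4.
  obtain ⟨c, hc⟩ := four_dvd_of_evalAt_cols₂ hA hd₁ hd₂ hj hjm (heven hj hjm)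
  rw [evalAt_single_one, hzj] at e
  rw [evalAt_single_one, evalAt_add, e, evalAt_single, hc] at e'
  simp only [Pi.add_apply, hzj, Pi.single_eq_same] at e'
  push_cast at e'
  have : ∀ x : ZMod 8, 2 * 0 * (0 - 1) + 4 * x * 2 ≠ 2 * (0 + 2) * (0 + 2 - 1) := by decide +kernel
  exact this _ e'

/-- The divisibility conditions on the coefficients say that the codeword has order at most two. -/
theorem two_nsmul_codeword_eq_zero (hA : HasColumns A p m) {l : Fin (k + 1) → ℤ}
    (h2 : ∀ i : Fin (k + 1), 0 < i.val → i.val ≤ m → 2 ∣ l i)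
    (h4 : ∀ i : Fin (k + 1), 0 < i.val → i.val ≤ p → 4 ∣ l i) : 2 • codeword A l = 0 := by
  refine Prod.ext ?_ (Prod.ext ?_ ?_) <;> funext j
  · exact (two_nsmul _).trans (CharTwo.add_self_eq_zero _)
  · obtain ⟨h0, hm, -⟩ := (hA.mem_cols₂ _).1 (List.get_mem A.cols₂ j)
    refine (two_nsmul _).trans (evalAt_add_evalAt_eq_zero fun i => ?_)
    obtain rfl | hi := Nat.eq_zero_or_pos i.val |>.imp_left (fun h => (Fin.ext h : i = 0))
    · rw [h0]; exact mul_zero _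
    · by_cases him : i.val ≤ m
      · obtain ⟨c, hc⟩ := h2 i hi him
        rw [hc]; push_cast
        have : ∀ x y : ZMod 4, 2 * x * (2 * y) = 0 := by decide
        exact this _ _
      · rw [hm i (by omega), mul_zero]
  · obtain ⟨h0, hp, hm, -⟩ := (hA.mem_cols₃ _).1 (List.get_mem A.cols₃ j)
    refine (two_nsmul _).trans (evalAt_add_evalAt_eq_zero fun i => ?_)
    obtain rfl | hi := Nat.eq_zero_or_pos i.val |>.imp_left (fun h => (Fin.ext h : i = 0))
    · rw [h0]; exact mul_zero _
    · by_cases hip : i.val ≤ p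
      · obtain ⟨c, hc⟩ := h4 i hi hip
        rw [hc]; push_cast
        have : ∀ x y : ZMod 8, 4 * x * (2 * y) = 0 := by decide +kernel
        exact this _ _
      by_cases him : i.val ≤ m
      · obtain ⟨c, hc⟩ := h2 i hi him
        have h := hp i (by omega)
        rw [hc]; push_cast
        linear_combination (c : ZMod 8) * h
      · rw [hm i (by omega), mul_zero]

/-- With at least two rows of order 4 or 8, every word of the kernel comes from a codeword of
order at most two. -/
theorem codeKernel_subset (hA : HasColumns A p m) (hm : 2 ≤ m) (hpm : p ≤ m) (hmk : m ≤ k) :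
    codeKernel (grayImage A.code) ⊆ Gray '' orderAtMostTwo A.code := by
  intro x hx
  have hadd {c : Place A.α₁ A.α₂ A.α₃ → ZMod 2} (hc : c ∈ grayImage A.code) :
      x + c ∈ grayImage A.code := by
    have hx : (fun c => x + c) '' grayImage A.code = grayImage A.code := hx
    rw [← hx]
    exact ⟨c, hc, rfl⟩
  obtain ⟨u, hu, rfl⟩ : x ∈ grayImage A.code := by
    simpa using hadd ⟨0, zero_mem _, Gray_zero⟩
  obtain ⟨l, rfl⟩ := mem_code_iff.1 hu
  have hl (n : Fin (k + 1) → ℤ) :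
      Gray (codeword A l) + Gray (codeword A n) ∈ grayImage A.code :=
    hadd ⟨_, mem_code_iff.2 ⟨n, rfl⟩, rfl⟩
  refine ⟨_, ⟨hu, addOrderOf_le_two_iff.2 (two_nsmul_codeword_eq_zero hA ?_ ?_)⟩, rfl⟩
  · exact fun i hi him => even_coeff_of_kernel hA hm hmk hl hi him
  · exact fun i hi hip => four_dvd_coeff_of_kernel hA hm hpm hmk hl hi hip

end Obstruction

end Z2Z4Z8

theorem mainTheorem1 (t₁ t₂ t₃ : ℕ) (ht₁ : 1 ≤ t₁) (ht₃ : 1 ≤ t₃)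
    (hnonlinear : ¬ Z2Z4Z8.IsLinearCode (Z2Z4Z8.grayImage (Z2Z4Z8.hadamardCode t₁ t₂ t₃))) :
    Z2Z4Z8.codeKernel (Z2Z4Z8.grayImage (Z2Z4Z8.hadamardCode t₁ t₂ t₃)) =
      Z2Z4Z8.Gray '' Z2Z4Z8.orderAtMostTwo (Z2Z4Z8.hadamardCode t₁ t₂ t₃) := by
  have hA := Z2Z4Z8.hasColumns_matrix842 (t₁ - 1) t₂ (t₃ - 1)
  refine (Z2Z4Z8.codeKernel_subset hA ?_ (by omega) (by omega)).antisymm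
    (Z2Z4Z8.grayImage_orderAtMostTwo_subset _)
  by_contra hm
  have hp : t₁ - 1 + 1 = 1 := by omega
  have hm : t₁ - 1 + t₂ + 1 = 1 := by omega
  rw [hp, hm] at hA
  exact hnonlinear (Z2Z4Z8.isLinearCode_grayImage (by omega) hA)
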